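/- Let $n\ge 0$ and $a=\xi_0<\xi_1<\dots<\xi_n<\xi_{n+1}=b$ be real numbers. Let $\rho_1,\dots,\rho_{n+1}$ be real with $\rho_k^2>0$, and let $q$ be a real-valued function that is continuous on each interval $(\xi_{k-1},\xi_k)$ and has finite one-sided limits at the end points of each of these intervals. Let $\delta_j,\gamma_j$ ($j=1,\dots,4$) and $\delta^{\pm}_{ij},\gamma^{\pm}_{ij}$ ($i=1,\dots,n$, $j=0,1$) be real numbers. For $1\le j<k\le 4$ let $\theta_{ijk}$ be the determinant formed by the $j$-th and $k$-th columns of $$\begin{pmatrix}\delta^+_{i1}&\delta^+_{i0}&\delta^-_{i1}&\delta^-_{i0}\\ \gamma^+_{i1}&\gamma^+_{i0}&\gamma^-_{i1}&\gamma^-_{i0}\end{pmatrix},$$ and let $\kappa_1=\delta_3\delta_2-\delta_4\delta_1$, $\kappa_2=\gamma_3\gamma_2-\gamma_4\gamma_1$. Assume $\theta_{ijk}>0$ for all $i$ and all $j<k$, and $\kappa_1,\kappa_2>0$. Let $\mathcal H=\bigoplus_{k=0}^{n}L_2(\xi_k,\xi_{k+1})\oplus\mathbb C^2$ be the complex Hilbert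 space with inner product $$\langle F,G\rangle=\sum_{k=0}^n\frac1{\rho_{k+1}^2}\prod_{i=1}^k\theta_{i12}\prod_{i=k+1}^n\theta_{i34}\int_{\xi_k}^{\xi_{k+1}}f\,\overline g\,dx+\frac{\prod_{i=1}^n\theta_{i34}}{\kappa_1}f_1\overline{g_1}+\frac{\prod_{i=1}^n\theta_{i12}}{\kappa_2}f_2\overline{g_2}$$ for $F=(f,f_1,f_2)$, $G=(g,g_1,g_2)$. Write $\ell f=-\rho_k^2f''+qf$ on $(\xi_{k-1},\xi_k)$, $k=1,\dots,n+1$, and $$B_a[f]=\delta_1f(a)-\delta_2f'(a),\quad B_a'[f]=\delta_3f(a)-\delta_4f'(a),\quad B_b[f]=\gamma_1f(b)-\gamma_2f'(b),\quad B_b'[f]=\gamma_3f(b)-\gamma_4f'(b),$$ where values at $a$ and $b$ are one-sided limits. Let $\mathfrak R$ be the linear operator in $\mathcal H$ whose domain consists of all $F=(f,B_a'[f],-B_b'[f])$ such that $f$ is differentiable on each $(\xi_{k-1},\xi_k)$, $f$ and $f'$ are locally absolutely continuous there and have finite one-sided limits at its end points, $\ell f\in L_2(\xi_{k-1},\xi_k)$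 for each $k$, and for $i=1,\dots,n$ $$\delta^-_{i1}f'(\xi_i-)+\delta^-_{i0}f(\xi_i-)+\delta^+_{i1}f'(\xi_i+)+\delta^+_{i0}f(\xi_i+)=0,$$ $$\gamma^-_{i1}f'(\xi_i-)+\gamma^-_{i0}f(\xi_i-)+\gamma^+_{i1}f'(\xi_i+)+\gamma^+_{i0}f(\xi_i+)=0,$$ and which acts by $\mathfrak R(f,B_a'[f],-B_b'[f])=(\ell f,B_a[f],B_b[f])$. Then $\mathfrak R$ has compact resolvent: for every real $\delta$ that is not an eigenvalue of $\mathfrak R$, the operator $\mathfrak R-\delta I$ maps the domain of $\mathfrak R$ bijectively onto $\mathcal H$, and its inverse $(\mathfrak R-\delta I)^{-1}:\mathcal H\to\mathcal H$ is a compact (in particular bounded) linear operator. -/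

import Mathlib

open MeasureTheory Set Filter Topology

noncomputable section

/-- Coefficients of a Sturm–Liouville problem on `(a, b)`, `a = ξ 0 < ξ 1 < ⋯ < ξ (n+1) = b`, with
spectral parameter in both boundary conditions and two transmission conditions at each of the
interior points `ξ 1, …, ξ n`. The pieces `(ξ k, ξ (k+1))` are indexed by `k : Fin (n + 1)`; the
interior points by `i : Fin n`, where `i` stands for the point `ξ (i+1)`. -/
structure BVTPData (n : ℕ) where
  ξ : Fin (n + 2) → ℝ
  ξ_strictMono : StrictMono ξ
  /-- the leading coefficient is `ρ k ^ 2` on the `k`-th piece -/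
  ρ : Fin (n + 1) → ℝ
  ρ_sq_pos : ∀ k, 0 < ρ k ^ 2
  /-- the potential -/
  q : ℝ → ℝ
  q_continuousOn : ∀ k : Fin (n + 1), ContinuousOn q (Ioo (ξ k.castSucc) (ξ k.succ))
  q_right_limit : ∀ k : Fin (n + 1), ∃ l : ℝ, Tendsto q (𝓝[>] (ξ k.castSucc)) (𝓝 l)
  q_left_limit : ∀ k : Fin (n + 1), ∃ l : ℝ, Tendsto q (𝓝[<] (ξ k.succ)) (𝓝 l)
  /-- coefficients of the boundary condition at `a` -/
  (δ₁ δ₂ δ₃ δ₄ : ℝ)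
  /-- coefficients of the boundary condition at `b` -/
  (γ₁ γ₂ γ₃ γ₄ : ℝ)
  /-- coefficients of the first transmission condition: `δm1`, `δm0`, `δp1`, `δp0` multiply
  `u'(ξ-)`, `u(ξ-)`, `u'(ξ+)`, `u(ξ+)` -/
  (δm1 δm0 δp1 δp0 : Fin n → ℝ)
  /-- coefficients of the second transmission condition, in the same order -/
  (γm1 γm0 γp1 γp0 : Fin n → ℝ)

namespace BVTPData

variable {n : ℕ} (P : BVTPData n)

/-- The `2 × 4` matrix of the transmission coefficients at the `i`-th interior point. -/
def transMatrix (i : Fin n) : Matrix (Fin 2) (Fin 4) ℝ :=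
  !![P.δp1 i, P.δp0 i, P.δm1 i, P.δm0 i;
     P.γp1 i, P.γp0 i, P.γm1 i, P.γm0 i]

/-- The determinant of columns `j` and `k` (counted from `0`) of the transmission matrix. -/
def θ (i : Fin n) (j k : Fin 4) : ℝ :=
  ((P.transMatrix i).submatrix id ![j, k]).det

def κ₁ : ℝ := !![P.δ₃, P.δ₄; P.δ₁, P.δ₂].det

def κ₂ : ℝ := !![P.γ₃, P.γ₄; P.γ₁, P.γ₂].det

end BVTPData

/-- The boundary value transmission problem: coefficients with all the minors `θ i j k`, `j < k`,
and both `κ₁`, `κ₂` positive. -/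
structure BVTP (n : ℕ) extends BVTPData n where
  θ_pos : ∀ (i : Fin n) (j k : Fin 4), j < k → 0 < toBVTPData.θ i j k
  κ₁_pos : 0 < toBVTPData.κ₁
  κ₂_pos : 0 < toBVTPData.κ₂

namespace BVTP

variable {n : ℕ} (P : BVTP n)

/-- The `k`-th open piece `(ξ k, ξ (k+1))`. -/
def piece (k : Fin (n + 1)) : Set ℝ := Ioo (P.ξ k.castSucc) (P.ξ k.succ)

/-- The `i`-th interior point. -/
def node (i : Fin n) : ℝ := P.ξ i.succ.castSucc

def a : ℝ := P.ξ 0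

def b : ℝ := P.ξ (Fin.last (n + 1))

/-! ### The Hilbert space -/

/-- The space `(L²(ξ 0, ξ 1) ⊕ ⋯ ⊕ L²(ξ n, ξ (n+1))) ⊕ ℂ²`. It carries the weighted inner product
defined below, not the norm of a product space. -/
def H : Type :=
  ((k : Fin (n + 1)) → Lp ℂ 2 (volume.restrict (P.piece k))) × ℂ × ℂ

instance : AddCommGroup P.H :=
  inferInstanceAs (AddCommGroup
    (((k : Fin (n + 1)) → Lp ℂ 2 (volume.restrict (P.piece k))) × ℂ × ℂ))

instance : Module ℂ P.H :=
  inferInstanceAs (Module ℂ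
    (((k : Fin (n + 1)) → Lp ℂ 2 (volume.restrict (P.piece k))) × ℂ × ℂ))

/-- The weight of the `k`-th piece: `ρ_k⁻²` times the product of the `θ_{i12}` over the interior
points to the left of the piece and of the `θ_{i34}` over those to its right. -/
def weight (k : Fin (n + 1)) : ℝ :=
  1 / P.ρ k ^ 2 * ((∏ i : Fin n with i.castSucc < k, P.θ i 0 1) *
    ∏ i : Fin n with k ≤ i.castSucc, P.θ i 2 3)

def weightA : ℝ := (∏ i : Fin n, P.θ i 2 3) / P.κ₁

def weightB : ℝ := (∏ i : Fin n, P.θ i 0 1) / P.κ₂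

lemma weight_pos (k : Fin (n + 1)) : 0 < P.weight k :=
  mul_pos (one_div_pos.2 (P.ρ_sq_pos k))
    (mul_pos (Finset.prod_pos fun i _ => P.θ_pos i 0 1 (by decide))
      (Finset.prod_pos fun i _ => P.θ_pos i 2 3 (by decide)))

lemma weightA_pos : 0 < P.weightA :=
  div_pos (Finset.prod_pos fun i _ => P.θ_pos i 2 3 (by decide)) P.κ₁_pos

lemma weightB_pos : 0 < P.weightB :=
  div_pos (Finset.prod_pos fun i _ => P.θ_pos i 0 1 (by decide)) P.κ₂_pos

/-- The weighted inner product, conjugate linear in the first argument;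
`inner ℂ (F.1 k) (G.1 k)` is the integral of `conj f * g` over the `k`-th piece. -/
def innerH (F G : P.H) : ℂ :=
  ∑ k, (P.weight k : ℂ) * inner ℂ (F.1 k) (G.1 k)
    + (P.weightA : ℂ) * (starRingEnd ℂ F.2.1 * G.2.1)
    + (P.weightB : ℂ) * (starRingEnd ℂ F.2.2 * G.2.2)

lemma innerH_self (F : P.H) : P.innerH F F =
    ((∑ k, P.weight k * ‖F.1 k‖ ^ 2 + P.weightA * ‖F.2.1‖ ^ 2 + P.weightB * ‖F.2.2‖ ^ 2 : ℝ) :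
      ℂ) := by
  simp only [innerH, inner_self_eq_norm_sq_to_K, Complex.conj_mul']
  push_cast
  rfl

/-- The laws of an inner product. -/
@[reducible]
def innerCore : InnerProductSpace.Core ℂ P.H where
  inner := P.innerH
  conj_inner_symm F G := by
    simp only [innerH, map_add, map_sum, map_mul, Complex.conj_ofReal, inner_conj_symm,
      Complex.conj_conj]
    simp only [mul_comm]
  re_inner_nonneg F := by
    have h1 := P.weightA_pos
    have h2 := P.weightB_pos
    have h3 : 0 ≤ ∑ k, P.weight k * ‖F.1 k‖ ^ 2 :=
      Finset.sum_nonneg fun k _ => mul_nonneg (P.weight_pos k).le (sq_nonneg _)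
    change 0 ≤ RCLike.re (P.innerH F F)
    rw [innerH_self]
    simp only [RCLike.re_to_complex, Complex.ofReal_re]
    positivity
  add_left F G K := by
    change ∑ k, (P.weight k : ℂ) * inner ℂ (F.1 k + G.1 k) (K.1 k)
      + (P.weightA : ℂ) * (starRingEnd ℂ (F.2.1 + G.2.1) * K.2.1)
      + (P.weightB : ℂ) * (starRingEnd ℂ (F.2.2 + G.2.2) * K.2.2) = P.innerH F K + P.innerH G K
    simp only [innerH, inner_add_left, map_add, mul_add, add_mul, Finset.sum_add_distrib]
    ring
  smul_left F G r := by
    change ∑ k, (P.weight k : ℂ) * inner ℂ (r • F.1 k) (G.1 k)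
      + (P.weightA : ℂ) * (starRingEnd ℂ (r * F.2.1) * G.2.1)
      + (P.weightB : ℂ) * (starRingEnd ℂ (r * F.2.2) * G.2.2) = starRingEnd ℂ r * P.innerH F G
    simp only [innerH, inner_smul_left, map_mul, mul_add, Finset.mul_sum]
    congr 1
    · congr 1
      · exact Finset.sum_congr rfl fun k _ => by ring
      · ring
    · ring
  definite F h := by
    have h1 := P.weightA_pos
    have h2 := P.weightB_pos
    have h3 : ∀ k ∈ Finset.univ, 0 ≤ P.weight k * ‖F.1 k‖ ^ 2 :=
      fun k _ => mul_nonneg (P.weight_pos k).le (sq_nonneg _)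
    have h3' := Finset.sum_nonneg h3
    have h4 : 0 ≤ P.weightA * ‖F.2.1‖ ^ 2 := by positivity
    have h5 : 0 ≤ P.weightB * ‖F.2.2‖ ^ 2 := by positivity
    change P.innerH F F = 0 at h
    rw [innerH_self, Complex.ofReal_eq_zero] at h
    have e1 : P.weightA * ‖F.2.1‖ ^ 2 = 0 := by linarith
    have e2 : P.weightB * ‖F.2.2‖ ^ 2 = 0 := by linarith
    have e3 : ∑ k, P.weight k * ‖F.1 k‖ ^ 2 = 0 := by linarith
    rw [Finset.sum_eq_zero_iff_of_nonneg h3] at e3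
    refine Prod.ext (funext fun k => ?_) (Prod.ext ?_ ?_)
    · have := e3 k (Finset.mem_univ k)
      exact norm_eq_zero.1 (by simpa [(P.weight_pos k).ne'] using this)
    · exact norm_eq_zero.1 (by simpa [h1.ne'] using e1)
    · exact norm_eq_zero.1 (by simpa [h2.ne'] using e2)

instance : NormedAddCommGroup P.H := P.innerCore.toNormedAddCommGroup

instance : InnerProductSpace ℂ P.H := InnerProductSpace.ofCore P.innerCore.toCore

/-! ### The operator -/

/-- `f ∈ AC_loc(c, d)`: absolutely continuous on every compact subinterval of `(c, d)`. -/
def ACLoc (f : ℝ → ℂ) (c d : ℝ) : Prop :=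
  ∀ x ∈ Ioo c d, ∀ y ∈ Ioo c d, AbsolutelyContinuousOnInterval f x y

/-- The differential expression `-ρ u'' + q u` on the `k`-th piece. -/
def ell (k : Fin (n + 1)) (f : ℝ → ℂ) (x : ℝ) : ℂ :=
  -((P.ρ k ^ 2 : ℝ) : ℂ) * deriv (deriv f) x + (P.q x : ℂ) * f x

/-- First transmission functional at the `i`-th interior point. -/
def trans₁ (i : Fin n) (f : ℝ → ℂ) : ℂ :=
  P.δm1 i * Function.leftLim (deriv f) (P.node i) + P.δm0 i * Function.leftLim f (P.node i)
    + P.δp1 i * Function.rightLim (deriv f) (P.node i) + P.δp0 i * Function.rightLim f (P.node i)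

/-- Second transmission functional at the `i`-th interior point. -/
def trans₂ (i : Fin n) (f : ℝ → ℂ) : ℂ :=
  P.γm1 i * Function.leftLim (deriv f) (P.node i) + P.γm0 i * Function.leftLim f (P.node i)
    + P.γp1 i * Function.rightLim (deriv f) (P.node i) + P.γp0 i * Function.rightLim f (P.node i)

/-- Boundary functional `B_a`; the values at the end points are the one-sided limits. -/
def Ba (f : ℝ → ℂ) : ℂ :=
  P.δ₁ * Function.rightLim f P.a - P.δ₂ * Function.rightLim (deriv f) P.a

/-- Boundary functional `B'_a`. -/
def Ba' (f : ℝ → ℂ) : ℂ :=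
  P.δ₃ * Function.rightLim f P.a - P.δ₄ * Function.rightLim (deriv f) P.a

/-- Boundary functional `B_b`. -/
def Bb (f : ℝ → ℂ) : ℂ :=
  P.γ₁ * Function.leftLim f P.b - P.γ₂ * Function.leftLim (deriv f) P.b

/-- Boundary functional `B'_b`. -/
def Bb' (f : ℝ → ℂ) : ℂ :=
  P.γ₃ * Function.leftLim f P.b - P.γ₄ * Function.leftLim (deriv f) P.b

/-- The functions which occur as first components of elements of the domain of the operator.
Only the restriction of `f` to the union of the open pieces matters. -/
structure Admissible (f : ℝ → ℂ) : Prop where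
  differentiableOn : ∀ k, DifferentiableOn ℝ f (P.piece k)
  acLoc : ∀ k : Fin (n + 1), ACLoc f (P.ξ k.castSucc) (P.ξ k.succ)
  acLoc_deriv : ∀ k : Fin (n + 1), ACLoc (deriv f) (P.ξ k.castSucc) (P.ξ k.succ)
  right_limit : ∀ k : Fin (n + 1), ∃ l : ℂ, Tendsto f (𝓝[>] (P.ξ k.castSucc)) (𝓝 l)
  left_limit : ∀ k : Fin (n + 1), ∃ l : ℂ, Tendsto f (𝓝[<] (P.ξ k.succ)) (𝓝 l)
  right_limit_deriv : ∀ k : Fin (n + 1),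
    ∃ l : ℂ, Tendsto (deriv f) (𝓝[>] (P.ξ k.castSucc)) (𝓝 l)
  left_limit_deriv : ∀ k : Fin (n + 1),
    ∃ l : ℂ, Tendsto (deriv f) (𝓝[<] (P.ξ k.succ)) (𝓝 l)
  memLp_ell : ∀ k, MemLp (P.ell k f) 2 (volume.restrict (P.piece k))
  trans₁_eq : ∀ i, P.trans₁ i f = 0
  trans₂_eq : ∀ i, P.trans₂ i f = 0

/-- `F = (f, B'_a[f], -B'_b[f])` and `G = (ℓ f, B_a[f], B_b[f])` for the function `f`. -/
structure Represents (f : ℝ → ℂ) (F G : P.H) : Prop where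
  admissible : P.Admissible f
  fst_eq : ∀ k, F.1 k =ᵐ[volume.restrict (P.piece k)] f
  fst_a : F.2.1 = P.Ba' f
  fst_b : F.2.2 = -P.Bb' f
  snd_eq : ∀ k, G.1 k =ᵐ[volume.restrict (P.piece k)] P.ell k f
  snd_a : G.2.1 = P.Ba f
  snd_b : G.2.2 = P.Bb f

lemma eventually_piece_right (k : Fin (n + 1)) :
    ∀ᶠ x in 𝓝[>] (P.ξ k.castSucc), x ∈ P.piece k :=
  Ioo_mem_nhdsGT (P.ξ_strictMono Fin.castSucc_lt_succ)

lemma eventually_piece_left (k : Fin (n + 1)) :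
    ∀ᶠ x in 𝓝[<] (P.ξ k.succ), x ∈ P.piece k :=
  Ioo_mem_nhdsLT (P.ξ_strictMono Fin.castSucc_lt_succ)

lemma isOpen_piece (k : Fin (n + 1)) : IsOpen (P.piece k) := isOpen_Ioo

lemma a_eq : P.a = P.ξ (Fin.castSucc 0) := rfl

lemma b_eq : P.b = P.ξ (Fin.last n).succ := rfl

lemma node_eq (i : Fin n) : P.node i = P.ξ i.castSucc.succ := rfl

lemma ACLoc.ae_differentiableAt {f : ℝ → ℂ} {c d : ℝ} (hf : ACLoc f c d) :
    ∀ᵐ x ∂(volume.restrict (Ioo c d)), DifferentiableAt ℝ f x := by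
  have h : LocallyBoundedVariationOn f (Ioo c d) := fun x y hx hy =>
    ((hf x hx y hy).boundedVariationOn).mono (inter_subset_right.trans Icc_subset_uIcc)
  rw [ae_restrict_iff' measurableSet_Ioo]
  filter_upwards [h.ae_differentiableWithinAt_of_mem] with x hx hxm
  exact (hx hxm).differentiableAt (Ioo_mem_nhds hxm.1 hxm.2)

section lin

variable {P} {f g : ℝ → ℂ}

lemma Admissible.differentiableAt (hf : P.Admissible f) {k : Fin (n + 1)} {x : ℝ}
    (hx : x ∈ P.piece k) : DifferentiableAt ℝ f x :=
  (hf.differentiableOn k).differentiableAt ((P.isOpen_piece k).mem_nhds hx)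

lemma Admissible.deriv_lin (hf : P.Admissible f) (hg : P.Admissible g) (c : ℂ)
    {k : Fin (n + 1)} {x : ℝ} (hx : x ∈ P.piece k) :
    deriv (c • f + g) x = (c • deriv f + deriv g) x := by
  rw [deriv_add ((hf.differentiableAt hx).const_smul c) (hg.differentiableAt hx),
    deriv_const_smul c (hf.differentiableAt hx)]
  rfl

lemma Admissible.ell_lin (hf : P.Admissible f) (hg : P.Admissible g) (c : ℂ) (k : Fin (n + 1)) :
    P.ell k (c • f + g) =ᵐ[volume.restrict (P.piece k)] c • P.ell k f + P.ell k g := by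
  filter_upwards [(hf.acLoc_deriv k).ae_differentiableAt, (hg.acLoc_deriv k).ae_differentiableAt,
    ae_restrict_mem measurableSet_Ioo] with x hx hy hxm
  have h1 : deriv (c • f + g) =ᶠ[𝓝 x] c • deriv f + deriv g := by
    filter_upwards [(P.isOpen_piece k).mem_nhds hxm] with y hy
    exact hf.deriv_lin hg c hy
  have h2 : deriv (deriv (c • f + g)) x = c * deriv (deriv f) x + deriv (deriv g) x := by
    rw [h1.deriv_eq, deriv_add (hx.const_smul c) hy, deriv_const_smul c hx]
    rfl
  simp only [ell, h2, Pi.add_apply, Pi.smul_apply, smul_eq_mul]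
  ring

lemma tendsto_lin {l : Filter ℝ} {u v : ℂ} (hf : Tendsto f l (𝓝 u)) (hg : Tendsto g l (𝓝 v))
    (c : ℂ) : Tendsto (c • f + g) l (𝓝 (c * u + v)) :=
  (hf.const_mul c).add hg

lemma rightLim_lin {x₀ : ℝ} (hf : ∃ l, Tendsto f (𝓝[>] x₀) (𝓝 l)) (hg : ∃ l, Tendsto g (𝓝[>] x₀) (𝓝 l))
    (c : ℂ) {h : ℝ → ℂ} (hh : h =ᶠ[𝓝[>] x₀] c • f + g) :
    Tendsto h (𝓝[>] x₀) (𝓝 (c * Function.rightLim f x₀ + Function.rightLim g x₀)) ∧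
    Function.rightLim h x₀ = c * Function.rightLim f x₀ + Function.rightLim g x₀ := by
  obtain ⟨u, hu⟩ := hf
  obtain ⟨v, hv⟩ := hg
  have := (tendsto_lin hu hv c).congr' hh.symm
  rw [rightLim_eq_of_tendsto hu, rightLim_eq_of_tendsto hv,
    rightLim_eq_of_tendsto this]
  exact ⟨this, rfl⟩

lemma leftLim_lin {x₀ : ℝ} (hf : ∃ l, Tendsto f (𝓝[<] x₀) (𝓝 l)) (hg : ∃ l, Tendsto g (𝓝[<] x₀) (𝓝 l))
    (c : ℂ) {h : ℝ → ℂ} (hh : h =ᶠ[𝓝[<] x₀] c • f + g) :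
    Tendsto h (𝓝[<] x₀) (𝓝 (c * Function.leftLim f x₀ + Function.leftLim g x₀)) ∧
    Function.leftLim h x₀ = c * Function.leftLim f x₀ + Function.leftLim g x₀ := by
  obtain ⟨u, hu⟩ := hf
  obtain ⟨v, hv⟩ := hg
  have := (tendsto_lin hu hv c).congr' hh.symm
  rw [leftLim_eq_of_tendsto hu, leftLim_eq_of_tendsto hv,
    leftLim_eq_of_tendsto this]
  exact ⟨this, rfl⟩

lemma Admissible.right_lin (hf : P.Admissible f) (hg : P.Admissible g) (c : ℂ) (k : Fin (n + 1)) :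
    Tendsto (c • f + g) (𝓝[>] (P.ξ k.castSucc))
      (𝓝 (c * Function.rightLim f (P.ξ k.castSucc) + Function.rightLim g (P.ξ k.castSucc))) ∧
    Function.rightLim (c • f + g) (P.ξ k.castSucc) =
      c * Function.rightLim f (P.ξ k.castSucc) + Function.rightLim g (P.ξ k.castSucc) :=
  rightLim_lin (hf.right_limit k) (hg.right_limit k) c (EventuallyEq.refl _ (c • f + g))

lemma Admissible.left_lin (hf : P.Admissible f) (hg : P.Admissible g) (c : ℂ) (k : Fin (n + 1)) :
    Tendsto (c • f + g) (𝓝[<] (P.ξ k.succ))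
      (𝓝 (c * Function.leftLim f (P.ξ k.succ) + Function.leftLim g (P.ξ k.succ))) ∧
    Function.leftLim (c • f + g) (P.ξ k.succ) =
      c * Function.leftLim f (P.ξ k.succ) + Function.leftLim g (P.ξ k.succ) :=
  leftLim_lin (hf.left_limit k) (hg.left_limit k) c (EventuallyEq.refl _ (c • f + g))

lemma Admissible.right_deriv_lin (hf : P.Admissible f) (hg : P.Admissible g) (c : ℂ)
    (k : Fin (n + 1)) :
    Tendsto (deriv (c • f + g)) (𝓝[>] (P.ξ k.castSucc))
      (𝓝 (c * Function.rightLim (deriv f) (P.ξ k.castSucc) + Function.rightLim (deriv g) (P.ξ k.castSucc))) ∧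
    Function.rightLim (deriv (c • f + g)) (P.ξ k.castSucc) =
      c * Function.rightLim (deriv f) (P.ξ k.castSucc) + Function.rightLim (deriv g) (P.ξ k.castSucc) :=
  rightLim_lin (hf.right_limit_deriv k) (hg.right_limit_deriv k) c (h := deriv (c • f + g))
    ((P.eventually_piece_right k).mono fun _ hx => hf.deriv_lin hg c hx)

lemma Admissible.left_deriv_lin (hf : P.Admissible f) (hg : P.Admissible g) (c : ℂ)
    (k : Fin (n + 1)) :
    Tendsto (deriv (c • f + g)) (𝓝[<] (P.ξ k.succ))
      (𝓝 (c * Function.leftLim (deriv f) (P.ξ k.succ) + Function.leftLim (deriv g) (P.ξ k.succ))) ∧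
    Function.leftLim (deriv (c • f + g)) (P.ξ k.succ) =
      c * Function.leftLim (deriv f) (P.ξ k.succ) + Function.leftLim (deriv g) (P.ξ k.succ) :=
  leftLim_lin (hf.left_limit_deriv k) (hg.left_limit_deriv k) c (h := deriv (c • f + g))
    ((P.eventually_piece_left k).mono fun _ hx => hf.deriv_lin hg c hx)

lemma ACLoc.congr {c d : ℝ} (hf : ACLoc f c d) (h : EqOn f g (Ioo c d)) : ACLoc g c d := by
  intro x hx y hy
  have hs : uIcc x y ⊆ Ioo c d := ordConnected_Ioo.uIcc_subset hx hy
  refine (hf x hx y hy).congr' ?_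
  filter_upwards [mem_inf_of_right (mem_principal_self _)] with E hE
  refine Finset.sum_congr rfl fun i hi => ?_
  rw [h (hs (hE.1 i hi).1), h (hs (hE.1 i hi).2)]

lemma ACLoc.lin {d e : ℝ} (hf : ACLoc f d e) (hg : ACLoc g d e) (c : ℂ) :
    ACLoc (c • f + g) d e := fun x hx y hy =>
  ((hf x hx y hy).const_smul c).add (hg x hx y hy)

lemma Admissible.lin (hf : P.Admissible f) (hg : P.Admissible g) (c : ℂ) :
    P.Admissible (c • f + g) where
  differentiableOn k := ((hf.differentiableOn k).const_smul c).add (hg.differentiableOn k)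
  acLoc k := (hf.acLoc k).lin (hg.acLoc k) c
  acLoc_deriv k := ((hf.acLoc_deriv k).lin (hg.acLoc_deriv k) c).congr
    fun _ hx => (hf.deriv_lin hg c (k := k) hx).symm
  right_limit k := ⟨_, (hf.right_lin hg c k).1⟩
  left_limit k := ⟨_, (hf.left_lin hg c k).1⟩
  right_limit_deriv k := ⟨_, (hf.right_deriv_lin hg c k).1⟩
  left_limit_deriv k := ⟨_, (hf.left_deriv_lin hg c k).1⟩
  memLp_ell k := (memLp_congr_ae (hf.ell_lin hg c k)).2
    (((hf.memLp_ell k).const_smul c).add (hg.memLp_ell k))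
  trans₁_eq i := by
    have h1 := hf.trans₁_eq i
    have h2 := hg.trans₁_eq i
    have e1 := (hf.left_lin hg c i.castSucc).2
    have e2 := (hf.left_deriv_lin hg c i.castSucc).2
    have e3 := (hf.right_lin hg c i.succ).2
    have e4 := (hf.right_deriv_lin hg c i.succ).2
    rw [← node_eq] at e1 e2
    change Function.rightLim _ (P.node i) = c * Function.rightLim _ (P.node i)
      + Function.rightLim _ (P.node i) at e3 e4
    rw [trans₁] at *
    rw [e1, e2, e3, e4]
    linear_combination c * h1 + h2
  trans₂_eq i := by
    have h1 := hf.trans₂_eq i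
    have h2 := hg.trans₂_eq i
    have e1 := (hf.left_lin hg c i.castSucc).2
    have e2 := (hf.left_deriv_lin hg c i.castSucc).2
    have e3 := (hf.right_lin hg c i.succ).2
    have e4 := (hf.right_deriv_lin hg c i.succ).2
    rw [← node_eq] at e1 e2
    change Function.rightLim _ (P.node i) = c * Function.rightLim _ (P.node i)
      + Function.rightLim _ (P.node i) at e3 e4
    rw [trans₂] at *
    rw [e1, e2, e3, e4]
    linear_combination c * h1 + h2

lemma Represents.lin {F G F' G' : P.H} (hf : P.Represents f F G) (hg : P.Represents g F' G')
    (c : ℂ) : P.Represents (c • f + g) (c • F + F') (c • G + G') := by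
  have e1 := (hf.admissible.right_lin hg.admissible c 0).2
  have e2 := (hf.admissible.right_deriv_lin hg.admissible c 0).2
  have e3 := (hf.admissible.left_lin hg.admissible c (Fin.last n)).2
  have e4 := (hf.admissible.left_deriv_lin hg.admissible c (Fin.last n)).2
  rw [← a_eq] at e1 e2
  rw [← b_eq] at e3 e4
  refine ⟨hf.admissible.lin hg.admissible c, fun k => ?_, ?_, ?_, fun k => ?_, ?_, ?_⟩
  · change (c • F.1 k + F'.1 k : Lp ℂ 2 (volume.restrict (P.piece k))) =ᵐ[_] _
    filter_upwards [Lp.coeFn_add (c • F.1 k) (F'.1 k), Lp.coeFn_smul c (F.1 k), hf.fst_eq k,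
      hg.fst_eq k] with x h1 h2 h3 h4
    rw [h1, Pi.add_apply, h2, Pi.smul_apply, h3, h4]
    rfl
  · change c * F.2.1 + F'.2.1 = _
    rw [hf.fst_a, hg.fst_a]
    simp only [Ba', e1, e2]
    ring
  · change c * F.2.2 + F'.2.2 = _
    rw [hf.fst_b, hg.fst_b]
    simp only [Bb', e3, e4]
    ring
  · change (c • G.1 k + G'.1 k : Lp ℂ 2 (volume.restrict (P.piece k))) =ᵐ[_] _
    filter_upwards [Lp.coeFn_add (c • G.1 k) (G'.1 k), Lp.coeFn_smul c (G.1 k), hf.snd_eq k,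
      hg.snd_eq k, hf.admissible.ell_lin hg.admissible c k] with x h1 h2 h3 h4 h5
    rw [h1, Pi.add_apply, h2, Pi.smul_apply, h3, h4, h5]
    rfl
  · change c * G.2.1 + G'.2.1 = _
    rw [hf.snd_a, hg.snd_a]
    simp only [Ba, e1, e2]
    ring
  · change c * G.2.2 + G'.2.2 = _
    rw [hf.snd_b, hg.snd_b]
    simp only [Bb, e3, e4]
    ring

lemma represents_zero : P.Represents 0 0 0 := by
  have hd : deriv (0 : ℝ → ℂ) = 0 := funext fun x => deriv_const x 0
  have hl : ∀ x, Function.leftLim (0 : ℝ → ℂ) x = 0 := fun x =>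
    leftLim_eq_of_tendsto tendsto_const_nhds
  have hr : ∀ x, Function.rightLim (0 : ℝ → ℂ) x = 0 := fun x =>
    rightLim_eq_of_tendsto tendsto_const_nhds
  have hac : ∀ c d, ACLoc 0 c d := fun c d x _ y _ => by
    simp [AbsolutelyContinuousOnInterval, tendsto_const_nhds]
  have hell : ∀ k, P.ell k 0 = 0 := fun k => funext fun x => by simp [ell, hd]
  refine ⟨⟨fun k => differentiableOn_const 0, fun k => hac _ _, fun k => by rw [hd]; exact hac _ _,
    fun k => ⟨0, tendsto_const_nhds⟩, fun k => ⟨0, tendsto_const_nhds⟩,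
    fun k => ⟨0, by rw [hd]; exact tendsto_const_nhds⟩, fun k => ⟨0, by rw [hd]; exact tendsto_const_nhds⟩,
    fun k => by rw [hell]; exact MemLp.zero, fun i => ?_, fun i => ?_⟩, fun k => ?_, ?_, ?_,
    fun k => ?_, ?_, ?_⟩
  · simp [trans₁, hd, hl, hr]
  · simp [trans₂, hd, hl, hr]
  · exact Lp.coeFn_zero _ _ _
  · simp only [Ba', hd, hr, mul_zero, sub_zero]; rfl
  · simp only [Bb', hd, hl, mul_zero, sub_zero, neg_zero]; rfl
  · rw [hell]; exact Lp.coeFn_zero _ _ _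
  · simp only [Ba, hd, hr, mul_zero, sub_zero]; rfl
  · simp only [Bb, hd, hl, mul_zero, sub_zero]; rfl

/-- The second entry of a represented pair is determined by the first. -/
lemma Represents.eq_zero {G : P.H} (hf : P.Represents f 0 G) : G = 0 := by
  have h0 : ∀ k, EqOn f 0 (P.piece k) := fun k =>
    Measure.eqOn_open_of_ae_eq ((hf.fst_eq k).symm.trans (Lp.coeFn_zero _ _ _))
      (P.isOpen_piece k) (hf.admissible.differentiableOn k).continuousOn continuousOn_const
  have h1 : ∀ k, EqOn (deriv f) 0 (P.piece k) := fun k x hx => by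
    have : f =ᶠ[𝓝 x] fun _ => 0 := (h0 k).eventuallyEq_of_mem ((P.isOpen_piece k).mem_nhds hx)
    rw [this.deriv_eq]
    simp
  have h2 : ∀ k, EqOn (deriv (deriv f)) 0 (P.piece k) := fun k x hx => by
    have : deriv f =ᶠ[𝓝 x] fun _ => 0 :=
      (h1 k).eventuallyEq_of_mem ((P.isOpen_piece k).mem_nhds hx)
    rw [this.deriv_eq]
    simp
  have hr : ∀ u : ℝ → ℂ, EqOn u 0 (P.piece 0) → Function.rightLim u P.a = 0 := fun u hu =>
    rightLim_eq_of_tendsto (tendsto_const_nhds.congr'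
      ((P.eventually_piece_right 0).mono fun x hx => (hu hx).symm))
  have hl : ∀ u : ℝ → ℂ, EqOn u 0 (P.piece (Fin.last n)) → Function.leftLim u P.b = 0 :=
    fun u hu => leftLim_eq_of_tendsto (tendsto_const_nhds.congr'
      ((P.eventually_piece_left (Fin.last n)).mono fun x hx => (hu hx).symm))
  refine Prod.ext (funext fun k => Lp.ext ?_) (Prod.ext ?_ ?_)
  · refine (hf.snd_eq k).trans (EventuallyEq.trans ?_ (Lp.coeFn_zero _ _ _).symm)
    filter_upwards [ae_restrict_mem measurableSet_Ioo] with x hx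
    simp [ell, h0 k hx, h2 k hx]
  · rw [hf.snd_a, Ba, hr _ (h0 _), hr _ (h1 _)]
    simp only [mul_zero, sub_zero]; rfl
  · rw [hf.snd_b, Bb, hl _ (h0 _), hl _ (h1 _)]
    simp only [mul_zero, sub_zero]; rfl

end lin

/-- The graph of the operator: all pairs `((f, B'_a[f], -B'_b[f]), (ℓ f, B_a[f], B_b[f]))` with
`f` admissible. -/
def opGraph : Submodule ℂ (P.H × P.H) where
  carrier := {p | ∃ f : ℝ → ℂ, P.Represents f p.1 p.2}
  zero_mem' := ⟨0, represents_zero⟩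
  add_mem' := by
    rintro p p' ⟨f, hf⟩ ⟨g, hg⟩
    exact ⟨(1 : ℂ) • f + g, by simpa only [one_smul, Prod.fst_add, Prod.snd_add] using hf.lin hg 1⟩
  smul_mem' := by
    rintro c p ⟨f, hf⟩
    exact ⟨c • f + 0, by simpa only [add_zero, Prod.smul_fst, Prod.smul_snd] using hf.lin represents_zero c⟩

/-- The operator `(f, B'_a[f], -B'_b[f]) ↦ (ℓ f, B_a[f], B_b[f])` in `H`, defined for all
admissible `f`. -/
def op : P.H →ₗ.[ℂ] P.H := P.opGraph.toLinearPMap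

lemma op_graph : P.op.graph = P.opGraph := by
  refine Submodule.toLinearPMap_graph_eq _ ?_
  rintro ⟨F, G⟩ ⟨f, hf⟩ hF
  obtain rfl : F = 0 := hF
  exact hf.eq_zero

lemma mem_op_domain_iff (F : P.H) : F ∈ P.op.domain ↔
    ∃ f : ℝ → ℂ, P.Admissible f ∧ (∀ k, F.1 k =ᵐ[volume.restrict (P.piece k)] f) ∧
      F.2.1 = P.Ba' f ∧ F.2.2 = -P.Bb' f := by
  rw [LinearPMap.mem_domain_iff, op_graph]
  constructor
  · rintro ⟨G, f, hf⟩
    exact ⟨f, hf.admissible, hf.fst_eq, hf.fst_a, hf.fst_b⟩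
  · rintro ⟨f, h1, h2, h3, h4⟩
    exact ⟨⟨fun k => (h1.memLp_ell k).toLp _, P.Ba f, P.Bb f⟩, f, h1, h2, h3, h4,
      fun k => (h1.memLp_ell k).coeFn_toLp, rfl, rfl⟩

end BVTP

namespace LinearPMap

variable {E : Type*} [NormedAddCommGroup E] [NormedSpace ℂ E]

/-- The point spectrum: the set of eigenvalues. -/
def pointSpectrum (A : E →ₗ.[ℂ] E) : Set ℂ :=
  {z | ∃ F : A.domain, (F : E) ≠ 0 ∧ A F = z • (F : E)}

/-- `T` is the resolvent `(A - z I)⁻¹`: a bounded operator on the whole space that maps into the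
domain of `A` and is a two-sided inverse of `A - z I : A.domain → E`. -/
def IsResolventAt (A : E →ₗ.[ℂ] E) (z : ℂ) (T : E →L[ℂ] E) : Prop :=
  (∀ G : E, ∃ h : T G ∈ A.domain, A ⟨T G, h⟩ - z • T G = G) ∧
    ∀ F : A.domain, T (A F - z • (F : E)) = F

end LinearPMap

end

/-! Solving `(R - z) F = G` means solving a second order linear equation on each piece, subject to
`2(n + 1)` scalar conditions: two at the ends and two at each interior point. Written as a first
order system for `(u, v) = (f, f')` and integrated from the left end of each piece, it becomes `u =
s₀ + ∫ v`, `v = s₁ + ∫ ρ⁻² ((q - z) u - G)`. The `2(n + 1)` initial values `s₀`, `s₁` are kept as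
unknowns alongside `u` and `v`, and the scalar conditions are written as fixed point equations `s =
s - cond + data`. The whole problem is then one equation `w = system z w + source G` in a Banach
space of continuous functions and scalars.

Integration from `L²` to continuous functions is compact: by Cauchy–Schwarz primitives are Hölder
continuous of order 1/2, and Arzelà–Ascoli applies (`isCompactOperator_primitive`). The remaining
parts have finite rank, so `system z` and `source` are compact (`isCompactOperator_system`,
`isCompactOperator_source`). By the Fredholm alternative, `1 - system z` is invertible unless
`system z` fixes some `w ≠ 0`.

Every solution `w` yields an element of the domain solving the original problem (`represents_glue`,
`exists_mem_domain`). A nonzero fixed point would therefore give an eigenvector for `z`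
(`eq_zero_of_system_eq`). When `z` is not an eigenvalue, the resolvent is `toH ∘ (1 - system z)⁻¹ ∘
source`, which is compact because `source` is. -/

noncomputable section

/-! ### Compact operators into finite products -/

section CompactOperator

variable {E : Type*} [TopologicalSpace E] [Zero E]

lemma IsCompactOperator.prodMk {F₁ F₂ : Type*} [TopologicalSpace F₁] [TopologicalSpace F₂]
    {f : E → F₁} {g : E → F₂} (hf : IsCompactOperator f) (hg : IsCompactOperator g) :
    IsCompactOperator fun x => (f x, g x) := by
  obtain ⟨K, hK, hfK⟩ := hf
  obtain ⟨L, hL, hgL⟩ := hg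
  exact ⟨K ×ˢ L, hK.prod hL, mem_of_superset (inter_mem hfK hgL) fun _ hx => ⟨hx.1, hx.2⟩⟩

lemma IsCompactOperator.pi {ι : Type*} [Finite ι] {F : ι → Type*} [∀ i, TopologicalSpace (F i)]
    {f : ∀ i, E → F i} (hf : ∀ i, IsCompactOperator (f i)) :
    IsCompactOperator fun x i => f i x := by
  choose K hK hfK using hf
  refine ⟨Set.univ.pi K, isCompact_univ_pi hK, mem_of_superset (iInter_mem.2 hfK) fun x hx => ?_⟩
  exact fun i _ => mem_iInter.1 hx i

lemma isCompactOperator_toSpanSingleton {F : Type*} [NormedAddCommGroup F] [NormedSpace ℂ F]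
    {x : F} : IsCompactOperator (ContinuousLinearMap.toSpanSingleton ℂ x) :=
  isCompactOperator_id.clm_comp (ContinuousLinearMap.toSpanSingleton ℂ x)

end CompactOperator

/-! ### Absolute continuity of primitives -/

/-- A function whose increments are dominated by those of an absolutely continuous function is
absolutely continuous. -/
lemma AbsolutelyContinuousOnInterval.of_dist_le {X Y : Type*} [PseudoMetricSpace X]
    [PseudoMetricSpace Y] {f : ℝ → X} {g : ℝ → Y} {a b : ℝ}
    (hg : AbsolutelyContinuousOnInterval g a b)
    (h : ∀ x ∈ uIcc a b, ∀ y ∈ uIcc a b, dist (f x) (f y) ≤ dist (g x) (g y)) :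
    AbsolutelyContinuousOnInterval f a b := by
  refine squeeze_zero' (Eventually.of_forall fun _ => Finset.sum_nonneg fun _ _ => dist_nonneg)
    ?_ hg
  filter_upwards [mem_inf_of_right (mem_principal_self _)] with E hE
  exact Finset.sum_le_sum fun i hi => h _ (hE.1 i hi).1 _ (hE.1 i hi).2

/-- The primitive of an integrable function is absolutely continuous. -/
lemma IntervalIntegrable.absolutelyContinuousOnInterval_primitive {E : Type*}
    [NormedAddCommGroup E] [NormedSpace ℝ E] {f : ℝ → E} {a b : ℝ}
    (h : IntervalIntegrable f volume a b) :
    AbsolutelyContinuousOnInterval (fun x => ∫ t in a..x, f t) a b := by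
  -- The increments are dominated by those of the real primitive of `‖f‖`, which reduces the
  -- vector-valued case to the scalar one.
  refine (h.norm.absolutelyContinuousOnInterval_intervalIntegral left_mem_uIcc).of_dist_le
    fun x hx y hy => ?_
  have hi : ∀ z ∈ uIcc a b, IntervalIntegrable f volume a z := fun z hz =>
    h.mono_set (uIcc_subset_uIcc left_mem_uIcc hz)
  rw [dist_comm, dist_eq_norm, dist_comm, dist_eq_norm,
    intervalIntegral.integral_interval_sub_left (hi y hy) (hi x hx),
    intervalIntegral.integral_interval_sub_left (hi y hy).norm (hi x hx).norm]
  exact intervalIntegral.norm_integral_le_abs_integral_norm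

/-! ### The integration operator on square integrable functions -/

namespace IntervalL2

variable {c d : ℝ}

/-- The space of square integrable functions on `(c, d)`. -/
abbrev L2 (c d : ℝ) : Type := Lp ℂ 2 (volume.restrict (Ioo c d))

/-- The Banach space of continuous functions on `[c, d]`. -/
abbrev ContFun (c d : ℝ) : Type := BoundedContinuousFunction (Icc c d) ℂ

/-- The extension of continuous functions from `[c, d]` to the line by constants. -/
def extend (h : c ≤ d) : ContFun c d →L[ℂ] BoundedContinuousFunction ℝ ℂ where
  toFun u := u.compContinuous ⟨projIcc c d h, continuous_projIcc⟩
  map_add' _ _ := rfl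
  map_smul' _ _ := rfl
  cont := BoundedContinuousFunction.continuous_compContinuous _

/-- The inclusion of the continuous functions on `[c, d]` into `L²(c, d)`. -/
def incl (h : c ≤ d) : ContFun c d →L[ℂ] L2 c d :=
  (BoundedContinuousFunction.toLp (E := ℂ) (p := 2) (volume.restrict (Ioo c d)) ℂ).comp (extend h)

lemma coeFn_incl (h : c ≤ d) (u : ContFun c d) :
    incl h u =ᵐ[volume.restrict (Ioo c d)] IccExtend h u :=
  BoundedContinuousFunction.coeFn_toLp (p := 2) (volume.restrict (Ioo c d)) ℂ (extend h u)

lemma intervalIntegrable (h : c ≤ d) (g : L2 c d) : IntervalIntegrable g volume c d := by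
  rw [intervalIntegrable_iff_integrableOn_Ioo_of_le h]
  exact (Lp.memLp g).integrable (by norm_num)

lemma intervalIntegrable_sub (h : c ≤ d) (g : L2 c d) {x y : ℝ} (hx : x ∈ Icc c d)
    (hy : y ∈ Icc c d) : IntervalIntegrable g volume x y :=
  (intervalIntegrable h g).mono_set (by
    rw [uIcc_of_le h]; exact ordConnected_Icc.uIcc_subset hx hy)

/-- Pairing with an indicator function makes both the linearity of the integral in `g` and the
Cauchy–Schwarz bound immediate. -/
lemma integral_eq_inner {x y : ℝ} (g : L2 c d) (hx : c ≤ x) (hxy : x ≤ y) (hy : y ≤ d) :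
    ∫ t in x..y, g t = inner ℂ (indicatorConstLp 2 (μ := volume.restrict (Ioo c d))
      measurableSet_Ioo (measure_ne_top _ (Ioo x y)) (1 : ℂ)) g := by
  rw [L2.inner_indicatorConstLp_one, intervalIntegral.integral_of_le hxy,
    integral_Ioc_eq_integral_Ioo, Measure.restrict_restrict measurableSet_Ioo,
    inter_eq_left.2 (Ioo_subset_Ioo hx hy)]

lemma norm_integral_le {x y : ℝ} (g : L2 c d) (hx : c ≤ x) (hxy : x ≤ y) (hy : y ≤ d) :
    ‖∫ t in x..y, g t‖ ≤ √(y - x) * ‖g‖ := by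
  rw [integral_eq_inner g hx hxy hy]
  refine (norm_inner_le_norm _ _).trans (mul_le_mul_of_nonneg_right ?_ (norm_nonneg _))
  rw [norm_indicatorConstLp (by norm_num) (by norm_num),
    measureReal_restrict_apply measurableSet_Ioo,
    inter_eq_left.2 (Ioo_subset_Ioo hx hy), Real.volume_real_Ioo_of_le hxy, Real.sqrt_eq_rpow]
  simp

/-- The modulus of continuity depends on `g` only through `‖g‖`, so primitives of a bounded set of
functions are equicontinuous. -/
lemma dist_primitive_le (h : c ≤ d) (g : L2 c d) {x y : ℝ} (hx : x ∈ Icc c d) (hy : y ∈ Icc c d) :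
    dist (∫ t in c..x, g t) (∫ t in c..y, g t) ≤ √(dist x y) * ‖g‖ := by
  wlog hxy : x ≤ y generalizing x y
  · rw [dist_comm, dist_comm x]
    exact this hy hx (le_of_not_ge hxy)
  rw [dist_comm, dist_eq_norm, dist_comm, Real.dist_eq, abs_of_nonneg (sub_nonneg.2 hxy),
    intervalIntegral.integral_interval_sub_left
      (intervalIntegrable_sub h g (left_mem_Icc.2 h) hy)
      (intervalIntegrable_sub h g (left_mem_Icc.2 h) hx)]
  exact norm_integral_le g hx.1 hxy hy.2

lemma norm_primitive_le (g : L2 c d) {x : ℝ} (hx : x ∈ Icc c d) :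
    ‖∫ t in c..x, g t‖ ≤ √(d - c) * ‖g‖ :=
  (norm_integral_le g le_rfl hx.1 hx.2).trans (mul_le_mul_of_nonneg_right
    (Real.sqrt_le_sqrt (by linarith [hx.2])) (norm_nonneg _))

lemma tendsto_sqrt_dist (C : ℝ) (x : Icc c d) :
    Tendsto (fun y : Icc c d => √(dist (x : ℝ) y) * C) (𝓝 x) (𝓝 0) := by
  have : Continuous fun y : Icc c d => √(dist (x : ℝ) y) * C := by fun_prop
  simpa using this.tendsto x

/-- The operator `g ↦ ∫ c..x, g` from `L²(c, d)` to the continuous functions on `[c, d]`. -/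
def primitive (h : c ≤ d) : L2 c d →L[ℂ] ContFun c d :=
  LinearMap.mkContinuous
    { toFun := fun g => BoundedContinuousFunction.ofNormedAddCommGroup
        (fun x : Icc c d => ∫ t in c..(x : ℝ), g t)
        (continuous_iff_continuousAt.2 fun x => tendsto_iff_dist_tendsto_zero.2
          (squeeze_zero (fun _ => dist_nonneg)
            (fun y => (dist_comm _ _).trans_le (dist_primitive_le h g x.2 y.2))
            (tendsto_sqrt_dist ‖g‖ x)))
        (√(d - c) * ‖g‖) fun x => norm_primitive_le g x.2
      map_add' := fun f g => by
        ext x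
        have hx (f : L2 c d) := integral_eq_inner f le_rfl x.2.1 x.2.2
        simp only [BoundedContinuousFunction.coe_ofNormedAddCommGroup,
          BoundedContinuousFunction.coe_add, Pi.add_apply, hx, inner_add_right]
      map_smul' := fun a g => by
        ext x
        have hx (f : L2 c d) := integral_eq_inner f le_rfl x.2.1 x.2.2
        simp only [BoundedContinuousFunction.coe_ofNormedAddCommGroup,
          BoundedContinuousFunction.coe_smul, RingHom.id_apply, hx, inner_smul_right, smul_eq_mul] }
    (√(d - c)) fun g => (BoundedContinuousFunction.norm_le (by positivity)).2 fun x =>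
      norm_primitive_le g x.2

@[simp]
lemma primitive_apply (h : c ≤ d) (g : L2 c d) (x : Icc c d) :
    primitive h g x = ∫ t in c..(x : ℝ), g t := rfl

/-- Arzelà–Ascoli: primitives of functions in the unit ball of `L²` take values in the ball of
radius `√(d - c)` and share the modulus of continuity `√|x - y|`. -/
lemma isCompactOperator_primitive (h : c ≤ d) : IsCompactOperator (primitive h) := by
  refine (isCompactOperator_iff_isCompact_closure_image_closedBall
    (primitive h : L2 c d →ₗ[ℂ] ContFun c d) one_pos).2 ?_
  refine BoundedContinuousFunction.arzela_ascoli (Metric.closedBall 0 (√(d - c)))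
    (isCompact_closedBall _ _) _ ?_ ?_
  · rintro _ x ⟨g, hg, rfl⟩
    rw [mem_closedBall_zero_iff] at hg ⊢
    exact (norm_primitive_le g x.2).trans (mul_le_of_le_one_right (by positivity) hg)
  · refine fun x => Metric.equicontinuousAt_of_continuity_modulus _ (tendsto_sqrt_dist 1 x) _ ?_
    refine Eventually.of_forall ?_
    rintro y ⟨_, g, hg, rfl⟩
    rw [mem_closedBall_zero_iff] at hg
    exact (dist_primitive_le h g x.2 y.2).trans (mul_le_mul_of_nonneg_left hg (by positivity))

/-! ### Regularity of primitives -/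

lemma IccExtend_eq_integral (h : c ≤ d) (a : ℂ) (g : L2 c d) {x : ℝ} (hx : x ∈ Icc c d) :
    IccExtend h (a • 1 + primitive h g : ContFun c d) x = a + ∫ t in c..x, g t := by
  rw [IccExtend_of_mem _ _ hx]
  simp

lemma IccExtend_eventuallyEq_integral (h : c ≤ d) (a : ℂ) (g : L2 c d) {x : ℝ}
    (hx : x ∈ Ioo c d) :
    IccExtend h (a • 1 + primitive h g : ContFun c d) =ᶠ[𝓝 x] fun y => a + ∫ t in c..y, g t := by
  filter_upwards [Icc_mem_nhds hx.1 hx.2] with y hy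
  exact IccExtend_eq_integral h a g hy

lemma acLoc_primitive (h : c ≤ d) (a : ℂ) (g : L2 c d) :
    BVTP.ACLoc (IccExtend h (a • 1 + primitive h g : ContFun c d)) c d := by
  intro x hx y hy
  have hsub : uIcc x y ⊆ Icc c d :=
    (ordConnected_Ioo.uIcc_subset hx hy).trans Ioo_subset_Icc_self
  have hac := (intervalIntegrable h g).absolutelyContinuousOnInterval_primitive
  refine AbsolutelyContinuousOnInterval.of_dist_le
    (hac.mono (by rwa [uIcc_of_le h])) fun s hs t ht => ?_
  rw [IccExtend_eq_integral h a g (hsub hs), IccExtend_eq_integral h a g (hsub ht),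
    dist_add_left]

/-- Lebesgue differentiation. Only almost every point is reached, which is enough for the second
derivative, since `ℓ f` matters only up to null sets. -/
lemma ae_hasDerivAt_primitive (h : c ≤ d) (a : ℂ) (g : L2 c d) :
    ∀ᵐ x ∂(volume.restrict (Ioo c d)),
      HasDerivAt (IccExtend h (a • 1 + primitive h g : ContFun c d)) (g x) x := by
  rw [ae_restrict_iff' measurableSet_Ioo]
  filter_upwards [(intervalIntegrable h g).ae_hasDerivAt_integral] with x hx hxm
  rw [uIcc_of_le h] at hx
  exact ((hx (Ioo_subset_Icc_self hxm) c (left_mem_Icc.2 h)).const_add a).congr_of_eventuallyEq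
    (IccExtend_eventuallyEq_integral h a g hxm)

/-- A continuous integrand gives a derivative at every point; this is what makes solutions
differentiable throughout each open piece. -/
lemma hasDerivAt_primitive_incl (h : c ≤ d) (a : ℂ) (v : ContFun c d) {x : ℝ} (hx : x ∈ Ioo c d) :
    HasDerivAt (IccExtend h (a • 1 + primitive h (incl h v) : ContFun c d)) (IccExtend h v x) x := by
  have hv : Continuous (IccExtend h v) := v.continuous.Icc_extend'
  refine ((hv.integral_hasStrictDerivAt c x).hasDerivAt.const_add a).congr_of_eventuallyEq ?_
  filter_upwards [Icc_mem_nhds hx.1 hx.2] with y hy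
  rw [IccExtend_eq_integral h a _ hy]
  congr 1
  rw [intervalIntegral.integral_of_le hy.1, intervalIntegral.integral_of_le hy.1,
    integral_Ioc_eq_integral_Ioo, integral_Ioc_eq_integral_Ioo]
  exact integral_congr_ae (ae_restrict_of_ae_restrict_of_subset
    (Ioo_subset_Ioo_right hy.2) (coeFn_incl h v))

end IntervalL2

open IntervalL2

namespace BVTP

variable {n : ℕ} (P : BVTP n)

lemma ξ_lt (k : Fin (n + 1)) : P.ξ k.castSucc < P.ξ k.succ :=
  P.ξ_strictMono Fin.castSucc_lt_succ

/-- The left end point of the `k`-th piece. -/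
def left (k : Fin (n + 1)) : Icc (P.ξ k.castSucc) (P.ξ k.succ) :=
  ⟨_, left_mem_Icc.2 (P.ξ_lt k).le⟩

/-- The right end point of the `k`-th piece. -/
def right (k : Fin (n + 1)) : Icc (P.ξ k.castSucc) (P.ξ k.succ) :=
  ⟨_, right_mem_Icc.2 (P.ξ_lt k).le⟩

/-! ### Coordinates of the Hilbert space -/

/-- The topology of `H` comes from the weighted inner product and not from a product norm, so
continuity of maps into and out of the coordinates rests on this formula. -/
lemma norm_sq_H (F : P.H) : ‖F‖ ^ 2 =
    ∑ k, P.weight k * ‖F.1 k‖ ^ 2 + P.weightA * ‖F.2.1‖ ^ 2 + P.weightB * ‖F.2.2‖ ^ 2 := by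
  rw [norm_sq_eq_re_inner (𝕜 := ℂ) F]
  change RCLike.re (P.innerH F F) = _
  rw [innerH_self]
  exact Complex.ofReal_re _

lemma norm_le_of_mul_sq_le {w s t : ℝ} (hw : 0 < w) (ht : 0 ≤ t) (h : w * s ^ 2 ≤ t ^ 2) :
    s ≤ (√w)⁻¹ * t := by
  have hw' := Real.sqrt_pos.2 hw
  rw [inv_mul_eq_div, le_div_iff₀' hw']
  refine abs_le_of_sq_le_sq' ?_ ht |>.2
  rwa [mul_pow, Real.sq_sqrt hw.le]

/-- The component of an element of `H` on the `k`-th piece. -/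
def fstCLM (k : Fin (n + 1)) : P.H →L[ℂ] L2 (P.ξ k.castSucc) (P.ξ k.succ) :=
  LinearMap.mkContinuous
    { toFun := fun F => F.1 k, map_add' := fun _ _ => rfl, map_smul' := fun _ _ => rfl }
    (√(P.weight k))⁻¹ fun F => norm_le_of_mul_sq_le (P.weight_pos k) (norm_nonneg _) (by
      have h := Finset.single_le_sum (f := fun k => P.weight k * ‖F.1 k‖ ^ 2)
        (fun k _ => mul_nonneg (P.weight_pos k).le (sq_nonneg _)) (Finset.mem_univ k)
      have := P.weightA_pos
      have := P.weightB_pos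
      rw [norm_sq_H]
      exact h.trans (by rw [add_assoc]; exact le_add_of_nonneg_right (by positivity)))

/-- The numerical component of an element of `H` at the left end point. -/
def aCLM : P.H →L[ℂ] ℂ :=
  LinearMap.mkContinuous
    { toFun := fun F => F.2.1, map_add' := fun _ _ => rfl, map_smul' := fun _ _ => rfl }
    (√P.weightA)⁻¹ fun F => norm_le_of_mul_sq_le P.weightA_pos (norm_nonneg _) (by
      have h := Finset.sum_nonneg (f := fun k => P.weight k * ‖F.1 k‖ ^ 2) (s := Finset.univ)
        (fun k _ => mul_nonneg (P.weight_pos k).le (sq_nonneg _))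
      have := P.weightB_pos
      have : 0 ≤ P.weightB * ‖F.2.2‖ ^ 2 := by positivity
      rw [norm_sq_H]
      change P.weightA * ‖F.2.1‖ ^ 2 ≤ _
      linarith)

/-- The numerical component of an element of `H` at the right end point. -/
def bCLM : P.H →L[ℂ] ℂ :=
  LinearMap.mkContinuous
    { toFun := fun F => F.2.2, map_add' := fun _ _ => rfl, map_smul' := fun _ _ => rfl }
    (√P.weightB)⁻¹ fun F => norm_le_of_mul_sq_le P.weightB_pos (norm_nonneg _) (by
      have h := Finset.sum_nonneg (f := fun k => P.weight k * ‖F.1 k‖ ^ 2) (s := Finset.univ)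
        (fun k _ => mul_nonneg (P.weight_pos k).le (sq_nonneg _))
      have := P.weightA_pos
      have : 0 ≤ P.weightA * ‖F.2.1‖ ^ 2 := by positivity
      rw [norm_sq_H]
      change P.weightB * ‖F.2.2‖ ^ 2 ≤ _
      linarith)

/-- Continuous linear maps into the components of `H` combine to one into `H`. -/
def mkCLM {E : Type*} [NormedAddCommGroup E] [NormedSpace ℂ E]
    (S : (k : Fin (n + 1)) → E →L[ℂ] L2 (P.ξ k.castSucc) (P.ξ k.succ)) (s t : E →L[ℂ] ℂ) :
    E →L[ℂ] P.H where
  toFun x := (fun k => S k x, s x, t x)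
  map_add' x y := Prod.ext (funext fun k => map_add (S k) x y)
    (Prod.ext (map_add s x y) (map_add t x y))
  map_smul' a x := Prod.ext (funext fun k => map_smul (S k) a x)
    (Prod.ext (map_smul s a x) (map_smul t a x))
  cont := by
    -- An additive map is continuous once it is so at `0`. There it suffices that `‖T x‖` tends to
    -- `0`, and `‖T x‖` is an explicit continuous expression in the components.
    let T : E →+ P.H :=
      { toFun := fun x => (fun k => S k x, s x, t x)
        map_zero' := Prod.ext (funext fun k => map_zero (S k))
          (Prod.ext (map_zero s) (map_zero t))
        map_add' := fun x y => Prod.ext (funext fun k => map_add (S k) x y)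
          (Prod.ext (map_add s x y) (map_add t x y)) }
    have hT : Continuous fun x => ‖T x‖ := by
      have h1 : (fun x => ‖T x‖) = fun x => √(∑ k, P.weight k * ‖S k x‖ ^ 2
          + P.weightA * ‖s x‖ ^ 2 + P.weightB * ‖t x‖ ^ 2) := funext fun x => by
        rw [← Real.sqrt_sq (norm_nonneg (T x)), norm_sq_H]
        rfl
      rw [h1]
      fun_prop
    refine continuous_of_continuousAt_zero T ?_
    rw [ContinuousAt, map_zero, tendsto_zero_iff_norm_tendsto_zero]
    simpa using hT.tendsto 0

/-! ### The integral equation -/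

/-- Unknowns of the integral equation: on each piece the function, its derivative, and the initial
values of both. -/
abbrev Phase : Type :=
  ((k : Fin (n + 1)) → ContFun (P.ξ k.castSucc) (P.ξ k.succ)) ×
    ((k : Fin (n + 1)) → ContFun (P.ξ k.castSucc) (P.ξ k.succ)) ×
      (Fin (n + 1) → ℂ) × (Fin (n + 1) → ℂ)

namespace Phase

/-- The function on the `k`-th piece. -/
def fn (k : Fin (n + 1)) : P.Phase →L[ℂ] ContFun (P.ξ k.castSucc) (P.ξ k.succ) :=
  (ContinuousLinearMap.proj k).comp (ContinuousLinearMap.fst ℂ _ _)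

/-- The derivative on the `k`-th piece. -/
def der (k : Fin (n + 1)) : P.Phase →L[ℂ] ContFun (P.ξ k.castSucc) (P.ξ k.succ) :=
  (ContinuousLinearMap.proj k).comp
    ((ContinuousLinearMap.fst ℂ _ _).comp (ContinuousLinearMap.snd ℂ _ _))

/-- The initial value of the function on the `k`-th piece. -/
def start₀ (k : Fin (n + 1)) : P.Phase →L[ℂ] ℂ :=
  (ContinuousLinearMap.proj k).comp ((ContinuousLinearMap.fst ℂ _ _).comp
    ((ContinuousLinearMap.snd ℂ _ _).comp (ContinuousLinearMap.snd ℂ _ _)))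

/-- The initial value of the derivative on the `k`-th piece. -/
def start₁ (k : Fin (n + 1)) : P.Phase →L[ℂ] ℂ :=
  (ContinuousLinearMap.proj k).comp ((ContinuousLinearMap.snd ℂ _ _).comp
    ((ContinuousLinearMap.snd ℂ _ _).comp (ContinuousLinearMap.snd ℂ _ _)))

/-- The value of the function at the left end point of the `k`-th piece. -/
def fnL (k : Fin (n + 1)) : P.Phase →L[ℂ] ℂ :=
  (BoundedContinuousFunction.evalCLM ℂ (P.left k)).comp (fn P k)

/-- The value of the function at the right end point of the `k`-th piece. -/
def fnR (k : Fin (n + 1)) : P.Phase →L[ℂ] ℂ :=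
  (BoundedContinuousFunction.evalCLM ℂ (P.right k)).comp (fn P k)

/-- The value of the derivative at the left end point of the `k`-th piece. -/
def derL (k : Fin (n + 1)) : P.Phase →L[ℂ] ℂ :=
  (BoundedContinuousFunction.evalCLM ℂ (P.left k)).comp (der P k)

/-- The value of the derivative at the right end point of the `k`-th piece. -/
def derR (k : Fin (n + 1)) : P.Phase →L[ℂ] ℂ :=
  (BoundedContinuousFunction.evalCLM ℂ (P.right k)).comp (der P k)

end Phase

open Phase

/-- The continuous extension of `q - z` to the closure of the `k`-th piece. -/
def pot (z : ℂ) (k : Fin (n + 1)) : ContFun (P.ξ k.castSucc) (P.ξ k.succ) :=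
  BoundedContinuousFunction.mkOfCompact
    ⟨fun x => ((extendFrom (Ioo (P.ξ k.castSucc) (P.ξ k.succ)) P.q x : ℝ) : ℂ) - z, by
      obtain ⟨l, hl⟩ := P.q_right_limit k
      obtain ⟨r, hr⟩ := P.q_left_limit k
      have := (continuousOn_Icc_extendFrom_Ioo (P.q_continuousOn k) hl hr).domRestrict
      exact (Complex.continuous_ofReal.comp this).sub continuous_const⟩

lemma pot_apply (z : ℂ) (k : Fin (n + 1)) {x : ℝ} (hx : x ∈ P.piece k) :
    pot P z k ⟨x, Ioo_subset_Icc_self hx⟩ = P.q x - z := by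
  have : extendFrom (Ioo (P.ξ k.castSucc) (P.ξ k.succ)) P.q x = P.q x :=
    extendFrom_eq (subset_closure hx) (P.q_continuousOn k x hx)
  simp [pot, this]

/-- The functional `B'_a` in terms of the end point values. -/
def bcA' : P.Phase →L[ℂ] ℂ := (P.δ₃ : ℂ) • fnL P 0 - (P.δ₄ : ℂ) • derL P 0

/-- The functional `-B'_b` in terms of the end point values. -/
def bcB' : P.Phase →L[ℂ] ℂ :=
  -((P.γ₃ : ℂ) • fnR P (Fin.last n) - (P.γ₄ : ℂ) • derR P (Fin.last n))

/-- The functional `B_a - z B'_a` and the first transmission functionals. -/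
def condA (z : ℂ) : Fin (n + 1) → P.Phase →L[ℂ] ℂ :=
  Fin.cases ((P.δ₁ : ℂ) • fnL P 0 - (P.δ₂ : ℂ) • derL P 0 - z • bcA' P) fun i =>
    (P.δm1 i : ℂ) • derR P i.castSucc + (P.δm0 i : ℂ) • fnR P i.castSucc
      + (P.δp1 i : ℂ) • derL P i.succ + (P.δp0 i : ℂ) • fnL P i.succ

/-- The functional `B_b + z B'_b` and the second transmission functionals. -/
def condB (z : ℂ) : Fin (n + 1) → P.Phase →L[ℂ] ℂ :=
  Fin.cases ((P.γ₁ : ℂ) • fnR P (Fin.last n) - (P.γ₂ : ℂ) • derR P (Fin.last n) - z • bcB' P)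
    fun i => (P.γm1 i : ℂ) • derR P i.castSucc + (P.γm0 i : ℂ) • fnR P i.castSucc
      + (P.γp1 i : ℂ) • derL P i.succ + (P.γp0 i : ℂ) • fnL P i.succ

/-- The integral form of the first order system `u' = v`. -/
def eqFn (k : Fin (n + 1)) : P.Phase →L[ℂ] ContFun (P.ξ k.castSucc) (P.ξ k.succ) :=
  (ContinuousLinearMap.toSpanSingleton ℂ 1).comp (start₀ P k)
    + (primitive (P.ξ_lt k).le).comp ((incl (P.ξ_lt k).le).comp (der P k))

/-- The integral form of `v' = ρ⁻² (q - z) u`. -/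
def eqDer (z : ℂ) (k : Fin (n + 1)) : P.Phase →L[ℂ] ContFun (P.ξ k.castSucc) (P.ξ k.succ) :=
  (ContinuousLinearMap.toSpanSingleton ℂ 1).comp (start₁ P k)
    + (primitive (P.ξ_lt k).le).comp ((((P.ρ k ^ 2 : ℝ) : ℂ)⁻¹ • incl (P.ξ_lt k).le).comp
        ((ContinuousLinearMap.mul ℂ _ (pot P z k)).comp (fn P k)))

/-- The problem `(R - z) F = G` is the equation `w = system z w + source G` for the phase `w`. -/
def system (z : ℂ) : P.Phase →L[ℂ] P.Phase :=
  (ContinuousLinearMap.pi (eqFn P)).prod ((ContinuousLinearMap.pi (eqDer P z)).prod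
    ((ContinuousLinearMap.pi fun k => start₀ P k - condA P z k).prod
      (ContinuousLinearMap.pi fun k => start₁ P k - condB P z k)))

/-- The inhomogeneity of the integral equation. -/
def source : P.H →L[ℂ] P.Phase :=
  (0 : P.H →L[ℂ] ((k : Fin (n + 1)) → ContFun (P.ξ k.castSucc) (P.ξ k.succ))).prod
    ((ContinuousLinearMap.pi fun k => (primitive (P.ξ_lt k).le).comp
      (-((P.ρ k ^ 2 : ℝ) : ℂ)⁻¹ • P.fstCLM k)).prod
    ((ContinuousLinearMap.pi (Fin.cases P.aCLM fun _ => 0)).prod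
      (ContinuousLinearMap.pi (Fin.cases P.bCLM fun _ => 0))))

/-- The element of `H` belonging to a phase. -/
def toH : P.Phase →L[ℂ] P.H :=
  P.mkCLM (fun k => (incl (P.ξ_lt k).le).comp (fn P k)) (bcA' P) (bcB' P)

/-- In the function components each term either has rank one or ends in `primitive`; the other
components are finitely many continuous functionals. -/
lemma isCompactOperator_system (z : ℂ) : IsCompactOperator (system P z) := by
  refine .prodMk (.pi fun k => ?_) (.prodMk (.pi fun k => ?_) (.prodMk (.pi fun k => ?_)
    (.pi fun k => ?_)))
  · exact (isCompactOperator_toSpanSingleton.comp_clm (start₀ P k)).add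
      ((isCompactOperator_primitive (P.ξ_lt k).le).comp_clm _)
  · exact (isCompactOperator_toSpanSingleton.comp_clm (start₁ P k)).add
      ((isCompactOperator_primitive (P.ξ_lt k).le).comp_clm _)
  · exact isCompactOperator_of_locallyCompactSpace_dom (start₀ P k - condA P z k)
  · exact isCompactOperator_of_locallyCompactSpace_dom (start₁ P k - condB P z k)

/-- The function part of `G` enters only through `primitive`, and the rest through two scalars.
Compactness of the resolvent comes from here. -/
lemma isCompactOperator_source : IsCompactOperator (source P) := by
  refine .prodMk isCompactOperator_zero (.prodMk (.pi fun k => ?_) (.prodMk (.pi fun k => ?_)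
    (.pi fun k => ?_)))
  · exact (isCompactOperator_primitive (P.ξ_lt k).le).comp_clm _
  · exact isCompactOperator_of_locallyCompactSpace_dom (Fin.cases P.aCLM (fun _ => 0) k)
  · exact isCompactOperator_of_locallyCompactSpace_dom (Fin.cases P.bCLM (fun _ => 0) k)

/-! ### Solutions of the integral equation -/

lemma disjoint_piece {j k : Fin (n + 1)} (h : j ≠ k) : Disjoint (P.piece j) (P.piece k) := by
  wlog hjk : j < k generalizing j k
  · exact (this h.symm (lt_of_le_of_ne (le_of_not_gt hjk) h.symm)).symm
  have : P.ξ j.succ ≤ P.ξ k.castSucc := P.ξ_strictMono.monotone (Fin.succ_le_castSucc_iff.2 hjk)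
  rw [Set.disjoint_left]
  exact fun x hx hx' => absurd (hx.2.trans_le this) (not_lt.2 hx'.1.le)

variable {P}

/-- The function on the line with the given restrictions to the pieces. -/
def glue (u : (k : Fin (n + 1)) → ContFun (P.ξ k.castSucc) (P.ξ k.succ)) (x : ℝ) : ℂ :=
  ∑ k, (P.piece k).indicator (IccExtend (P.ξ_lt k).le (u k)) x

lemma glue_eqOn (u : (k : Fin (n + 1)) → ContFun (P.ξ k.castSucc) (P.ξ k.succ))
    (k : Fin (n + 1)) : EqOn (glue u) (IccExtend (P.ξ_lt k).le (u k)) (P.piece k) := by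
  intro x hx
  rw [glue, Finset.sum_eq_single k, indicator_of_mem hx]
  · exact fun j _ hj => indicator_of_notMem
      (fun hx' => Set.disjoint_left.1 (P.disjoint_piece hj) hx' hx) _
  · exact fun h => absurd (Finset.mem_univ k) h

/-! ### One-sided limits at the end points of the pieces -/

section limits

variable {f : ℝ → ℂ} {k : Fin (n + 1)} {u : ContFun (P.ξ k.castSucc) (P.ξ k.succ)}

lemma tendsto_left (h : EqOn f (IccExtend (P.ξ_lt k).le u) (P.piece k)) :
    Tendsto f (𝓝[>] (P.ξ k.castSucc)) (𝓝 (u (P.left k))) := by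
  have hu : Continuous (IccExtend (P.ξ_lt k).le u) := u.continuous.Icc_extend'
  have : Tendsto _ (𝓝[>] (P.ξ k.castSucc)) _ :=
    (hu.tendsto (P.ξ k.castSucc)).mono_left nhdsWithin_le_nhds
  rw [IccExtend_of_mem _ _ (left_mem_Icc.2 (P.ξ_lt k).le)] at this
  exact this.congr' ((P.eventually_piece_right k).mono fun x hx => (h hx).symm)

lemma tendsto_right (h : EqOn f (IccExtend (P.ξ_lt k).le u) (P.piece k)) :
    Tendsto f (𝓝[<] (P.ξ k.succ)) (𝓝 (u (P.right k))) := by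
  have hu : Continuous (IccExtend (P.ξ_lt k).le u) := u.continuous.Icc_extend'
  have : Tendsto _ (𝓝[<] (P.ξ k.succ)) _ :=
    (hu.tendsto (P.ξ k.succ)).mono_left nhdsWithin_le_nhds
  rw [IccExtend_of_mem _ _ (right_mem_Icc.2 (P.ξ_lt k).le)] at this
  exact this.congr' ((P.eventually_piece_left k).mono fun x hx => (h hx).symm)

end limits

variable {z : ℂ} {w : P.Phase} {G : P.H}

lemma rightLim_glue (k : Fin (n + 1)) :
    Function.rightLim (glue w.1) (P.ξ k.castSucc) = fnL P k w :=
  rightLim_eq_of_tendsto (tendsto_left (glue_eqOn w.1 k))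

lemma leftLim_glue (k : Fin (n + 1)) :
    Function.leftLim (glue w.1) (P.ξ k.succ) = fnR P k w :=
  leftLim_eq_of_tendsto (tendsto_right (glue_eqOn w.1 k))

lemma fn_eq (h : w = system P z w + source P G) (k : Fin (n + 1)) : fn P k w =
    start₀ P k w • 1 + primitive (P.ξ_lt k).le (incl (P.ξ_lt k).le (der P k w)) :=
  (congrArg (fn P k) h).trans (add_zero _)

lemma der_eq (h : w = system P z w + source P G) (k : Fin (n + 1)) :
    der P k w = start₁ P k w • 1 + primitive (P.ξ_lt k).le
    (((P.ρ k ^ 2 : ℝ) : ℂ)⁻¹ • (incl (P.ξ_lt k).le (pot P z k * fn P k w) - P.fstCLM k G)) := by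
  have h1 : der P k w = eqDer P z k w + primitive (P.ξ_lt k).le
      ((-((P.ρ k ^ 2 : ℝ) : ℂ)⁻¹ • P.fstCLM k) G) := congrArg (der P k) h
  rw [h1, eqDer]
  simp only [add_apply, ContinuousLinearMap.comp_apply,
    smul_apply, ContinuousLinearMap.toSpanSingleton_apply,
    ContinuousLinearMap.mul_apply']
  rw [add_assoc, ← map_add, neg_smul, ← sub_eq_add_neg, ← smul_sub]

/-- The `start₀` component of the equation reads `s = s - cond + data`; cancelling `s` leaves the
boundary or transmission condition itself. -/
lemma condA_eq (h : w = system P z w + source P G) (k : Fin (n + 1)) :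
    condA P z k w = (Fin.cases P.aCLM (fun _ => 0) k : P.H →L[ℂ] ℂ) G := by
  have := congrArg (start₀ P k) h
  change _ = start₀ P k w - condA P z k w
    + (Fin.cases P.aCLM (fun _ => 0) k : P.H →L[ℂ] ℂ) G at this
  linear_combination this

lemma condB_eq (h : w = system P z w + source P G) (k : Fin (n + 1)) :
    condB P z k w = (Fin.cases P.bCLM (fun _ => 0) k : P.H →L[ℂ] ℂ) G := by
  have := congrArg (start₁ P k) h
  change _ = start₁ P k w - condB P z k w
    + (Fin.cases P.bCLM (fun _ => 0) k : P.H →L[ℂ] ℂ) G at this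
  linear_combination this

lemma hasDerivAt_glue (h : w = system P z w + source P G) {k : Fin (n + 1)} {x : ℝ}
    (hx : x ∈ P.piece k) :
    HasDerivAt (glue w.1) (IccExtend (P.ξ_lt k).le (der P k w) x) x := by
  have h1 := hasDerivAt_primitive_incl (P.ξ_lt k).le (start₀ P k w) (der P k w) hx
  rw [← fn_eq h k] at h1
  exact h1.congr_of_eventuallyEq
    ((glue_eqOn w.1 k).eventuallyEq_of_mem ((P.isOpen_piece k).mem_nhds hx))

lemma deriv_glue_eqOn (h : w = system P z w + source P G) (k : Fin (n + 1)) :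
    EqOn (deriv (glue w.1)) (IccExtend (P.ξ_lt k).le (der P k w)) (P.piece k) :=
  fun _ hx => (hasDerivAt_glue h hx).deriv

/-- The derivative `v` is a primitive of `ρ⁻² ((q - z) u - G)`, so almost everywhere `-ρ² u'' = G -
(q - z) u`; adding `q u` leaves `G + z u`. As this lies in `L²`, so does `ℓ f`. -/
lemma ell_glue (h : w = system P z w + source P G) (k : Fin (n + 1)) :
    P.ell k (glue w.1) =ᵐ[volume.restrict (P.piece k)]
    (P.fstCLM k G + z • incl (P.ξ_lt k).le (fn P k w) : L2 (P.ξ k.castSucc) (P.ξ k.succ)) := by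
  have h1 := ae_hasDerivAt_primitive (P.ξ_lt k).le (start₁ P k w)
    (((P.ρ k ^ 2 : ℝ) : ℂ)⁻¹ • (incl (P.ξ_lt k).le (pot P z k * fn P k w) - P.fstCLM k G))
  rw [← der_eq h k] at h1
  have hρ : ((P.ρ k ^ 2 : ℝ) : ℂ) ≠ 0 := by exact_mod_cast (P.ρ_sq_pos k).ne'
  filter_upwards [h1, ae_restrict_mem measurableSet_Ioo,
    Lp.coeFn_smul ((P.ρ k ^ 2 : ℝ) : ℂ)⁻¹
      (incl (P.ξ_lt k).le (pot P z k * fn P k w) - P.fstCLM k G),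
    Lp.coeFn_sub (incl (P.ξ_lt k).le (pot P z k * fn P k w)) (P.fstCLM k G),
    coeFn_incl (P.ξ_lt k).le (pot P z k * fn P k w),
    Lp.coeFn_add (P.fstCLM k G) (z • incl (P.ξ_lt k).le (fn P k w)),
    Lp.coeFn_smul z (incl (P.ξ_lt k).le (fn P k w)),
    coeFn_incl (P.ξ_lt k).le (fn P k w)] with x hd hx e1 e2 e3 e4 e5 e6
  have hx' : x ∈ Icc (P.ξ k.castSucc) (P.ξ k.succ) := Ioo_subset_Icc_self hx
  have hdd : deriv (deriv (glue w.1)) x = _ :=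
    (hd.congr_of_eventuallyEq ((deriv_glue_eqOn h k).eventuallyEq_of_mem
      ((P.isOpen_piece k).mem_nhds hx))).deriv
  have hf : glue w.1 x = fn P k w ⟨x, hx'⟩ :=
    (glue_eqOn w.1 k hx).trans (IccExtend_of_mem _ _ hx')
  rw [IccExtend_of_mem _ _ hx'] at e3 e6
  rw [ell, hdd, e1, e4, Pi.add_apply, e5, Pi.smul_apply, Pi.smul_apply, e2, Pi.sub_apply, e3, e6,
    hf, BoundedContinuousFunction.mul_apply, pot_apply P z k hx, smul_eq_mul, smul_eq_mul,
    neg_mul, mul_inv_cancel_left₀ hρ]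
  ring

lemma rightLim_deriv_glue (h : w = system P z w + source P G) (k : Fin (n + 1)) :
    Function.rightLim (deriv (glue w.1)) (P.ξ k.castSucc) = derL P k w :=
  rightLim_eq_of_tendsto (tendsto_left (deriv_glue_eqOn h k))

lemma leftLim_deriv_glue (h : w = system P z w + source P G) (k : Fin (n + 1)) :
    Function.leftLim (deriv (glue w.1)) (P.ξ k.succ) = derR P k w :=
  leftLim_eq_of_tendsto (tendsto_right (deriv_glue_eqOn h k))

lemma admissible_glue (h : w = system P z w + source P G) : P.Admissible (glue w.1) where
  differentiableOn k x hx := (hasDerivAt_glue h hx).differentiableAt.differentiableWithinAt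
  acLoc k := by
    have := acLoc_primitive (P.ξ_lt k).le (start₀ P k w) (incl (P.ξ_lt k).le (der P k w))
    rw [← fn_eq h k] at this
    exact this.congr (glue_eqOn w.1 k).symm
  acLoc_deriv k := by
    have := acLoc_primitive (P.ξ_lt k).le (start₁ P k w) (((P.ρ k ^ 2 : ℝ) : ℂ)⁻¹ •
      (incl (P.ξ_lt k).le (pot P z k * fn P k w) - P.fstCLM k G))
    rw [← der_eq h k] at this
    exact this.congr (deriv_glue_eqOn h k).symm
  right_limit k := ⟨_, tendsto_left (glue_eqOn w.1 k)⟩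
  left_limit k := ⟨_, tendsto_right (glue_eqOn w.1 k)⟩
  right_limit_deriv k := ⟨_, tendsto_left (deriv_glue_eqOn h k)⟩
  left_limit_deriv k := ⟨_, tendsto_right (deriv_glue_eqOn h k)⟩
  memLp_ell k := (memLp_congr_ae (ell_glue h k)).2 (Lp.memLp _)
  trans₁_eq i := by
    -- The node is both the right end of piece `i.castSucc` and the left end of piece `i.succ`;
    -- `Fin.succ_castSucc` passes from the first description to the second. The datum of index
    -- `i.succ` is `0`.
    rw [trans₁, node_eq, leftLim_deriv_glue h, leftLim_glue, Fin.succ_castSucc,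
      rightLim_deriv_glue h, rightLim_glue]
    exact condA_eq h i.succ
  trans₂_eq i := by
    rw [trans₂, node_eq, leftLim_deriv_glue h, leftLim_glue, Fin.succ_castSucc,
      rightLim_deriv_glue h, rightLim_glue]
    exact condB_eq h i.succ

/-- The conditions of index `0` give the scalar entries: `B_a - z B'_a = G_a` and `B_b + z B'_b =
G_b`, where the plus sign matches the entry `-B'_b` of the domain element. -/
lemma represents_glue (h : w = system P z w + source P G) :
    P.Represents (glue w.1) (toH P w) (G + z • toH P w) where
  admissible := admissible_glue h
  fst_eq k := (coeFn_incl (P.ξ_lt k).le (fn P k w)).trans (by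
    filter_upwards [ae_restrict_mem measurableSet_Ioo] with x hx
    exact (glue_eqOn w.1 k hx).symm)
  fst_a := by
    rw [Ba', a_eq, rightLim_glue, rightLim_deriv_glue h]
    rfl
  fst_b := by
    rw [Bb', b_eq, leftLim_glue, leftLim_deriv_glue h]
    rfl
  snd_eq k := (ell_glue h k).symm
  snd_a := by
    have := condA_eq h 0
    rw [Ba, a_eq, rightLim_glue, rightLim_deriv_glue h]
    change P.δ₁ * fnL P 0 w - P.δ₂ * derL P 0 w - z * bcA' P w = G.2.1 at this
    change G.2.1 + z * bcA' P w = _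
    linear_combination -this
  snd_b := by
    have := condB_eq h 0
    rw [Bb, b_eq, leftLim_glue, leftLim_deriv_glue h]
    change P.γ₁ * fnR P (Fin.last n) w - P.γ₂ * derR P (Fin.last n) w - z * bcB' P w
      = G.2.2 at this
    change G.2.2 + z * bcB' P w = _
    linear_combination -this

lemma exists_mem_domain (h : w = system P z w + source P G) :
    ∃ hw : toH P w ∈ P.op.domain, P.op ⟨toH P w, hw⟩ = G + z • toH P w := by
  have hg : (toH P w, G + z • toH P w) ∈ P.op.graph := by
    rw [op_graph]
    exact ⟨_, represents_glue h⟩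
  obtain ⟨⟨F, hF⟩, h1, h2⟩ := (LinearPMap.mem_graph_iff _).1 hg
  obtain rfl : F = toH P w := h1
  exact ⟨hF, h2⟩

/-- A phase solving the homogeneous equation vanishes if `z` is not an eigenvalue. -/
lemma eq_zero_of_system_eq (hz : z ∉ P.op.pointSpectrum) (h : system P z w = w) : w = 0 := by
  have h' : w = system P z w + source P 0 := by rw [map_zero, add_zero, h]
  obtain ⟨hw, hop⟩ := exists_mem_domain h'
  -- With `G = 0` the element `toH w` satisfies `R F = z F`, so it must vanish. It remains to
  -- recover `w = 0` from this, as `toH` discards the derivatives and the initial values.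
  have hH : toH P w = 0 := by
    by_contra hne
    exact hz ⟨⟨_, hw⟩, hne, by rw [hop, zero_add]⟩
  have hf (k : Fin (n + 1)) : EqOn (glue w.1) 0 (P.piece k) := by
    have hr := represents_glue h'
    rw [hH] at hr
    exact Measure.eqOn_open_of_ae_eq ((hr.fst_eq k).symm.trans (Lp.coeFn_zero _ _ _))
      (P.isOpen_piece k) (hr.admissible.differentiableOn k).continuousOn continuousOn_const
  have hd (k : Fin (n + 1)) : EqOn (deriv (glue w.1)) 0 (P.piece k) := fun x hx => by
    have : glue w.1 =ᶠ[𝓝 x] fun _ => 0 :=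
      (hf k).eventuallyEq_of_mem ((P.isOpen_piece k).mem_nhds hx)
    rw [this.deriv_eq]
    simp
  -- A continuous function vanishing on the open piece vanishes on its closure.
  have key (k : Fin (n + 1)) (u : ContFun (P.ξ k.castSucc) (P.ξ k.succ))
      (hu : EqOn (IccExtend (P.ξ_lt k).le u) 0 (P.piece k)) : u = 0 := by
    have hc : Continuous (IccExtend (P.ξ_lt k).le u) := u.continuous.Icc_extend'
    ext x
    have := hu.closure hc continuous_const
    rw [piece, closure_Ioo (P.ξ_lt k).ne] at this
    rw [← IccExtend_val (P.ξ_lt k).le u x]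
    exact this x.2
  have hu (k : Fin (n + 1)) : fn P k w = 0 := key k _ ((glue_eqOn w.1 k).symm.trans (hf k))
  have hv (k : Fin (n + 1)) : der P k w = 0 :=
    key k _ ((deriv_glue_eqOn h' k).symm.trans (hd k))
  -- The primitive vanishes at the left end point, so evaluation there isolates the initial value.
  have prim (k : Fin (n + 1)) (a : ℂ) (g : L2 (P.ξ k.castSucc) (P.ξ k.succ))
      (hg : (0 : ContFun _ _) = a • 1 + primitive (P.ξ_lt k).le g) : a = 0 := by
    have := DFunLike.congr_fun hg (P.left k)
    simpa [left] using this.symm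
  refine Prod.ext (funext hu) (Prod.ext (funext hv) (Prod.ext (funext fun k => ?_)
    (funext fun k => ?_)))
  · exact prim k _ _ ((hu k).symm.trans (fn_eq h' k))
  · exact prim k _ _ ((hv k).symm.trans (der_eq h' k))

end BVTP

end

/-! ### Fredholm alternative and the resolvent -/

theorem mainTheorem3 {n : ℕ} (P : BVTP n) (δ : ℝ) (hδ : (δ : ℂ) ∉ P.op.pointSpectrum) :
    ∃ T : P.H →L[ℂ] P.H, P.op.IsResolventAt (δ : ℂ) T ∧ IsCompactOperator T := by
  -- Fredholm alternative for the compact operator `system`: since `1` is not an eigenvalue, `1 -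
  -- system` has a bounded inverse, of which only the right inverse property is needed below.
  have hres : (1 : ℂ) ∈ resolventSet ℂ (BVTP.system P δ) := by
    refine ((P.isCompactOperator_system δ).hasEigenvalue_or_mem_resolventSet
      one_ne_zero).resolve_left fun hev => ?_
    obtain ⟨w, hw⟩ := hev.exists_hasEigenvector
    exact hw.2 (BVTP.eq_zero_of_system_eq hδ (by simpa using hw.apply_eq_smul))
  rw [spectrum.mem_resolventSet_iff, map_one] at hres
  obtain ⟨S, hS⟩ := hres.exists_right_inv
  have hsol (G : P.H) : S (P.source G) = P.system δ (S (P.source G)) + P.source G := by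
    have := DFunLike.congr_fun hS (P.source G)
    change S (P.source G) - P.system δ (S (P.source G)) = P.source G at this
    rw [← sub_eq_iff_eq_add', this]
  have hdom (G : P.H) : ∃ h : P.toH (S (P.source G)) ∈ P.op.domain,
      P.op ⟨_, h⟩ - (δ : ℂ) • P.toH (S (P.source G)) = G := by
    obtain ⟨h, hop⟩ := BVTP.exists_mem_domain (hsol G)
    exact ⟨h, by rw [hop, add_sub_cancel_right]⟩
  refine ⟨P.toH.comp (S.comp P.source), ⟨hdom, fun F => ?_⟩,
    (P.isCompactOperator_source.clm_comp S).clm_comp P.toH⟩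
  -- The right inverse is also a left inverse because `R - δ` is injective: if `T (R - δ) F`
  -- differed from `F`, the difference would be an eigenvector for `δ`.
  obtain ⟨h, hop⟩ := hdom (P.op F - (δ : ℂ) • (F : P.H))
  by_contra hne
  refine hδ ⟨⟨_, h⟩ - F, sub_ne_zero.2 hne, ?_⟩
  rw [LinearPMap.map_sub, AddSubgroupClass.coe_sub, smul_sub]
  rw [sub_eq_iff_eq_add] at hop
  change P.op ⟨_, h⟩ - P.op F = (δ : ℂ) • P.toH (S (P.source _)) - (δ : ℂ) • (F : P.H)
  rw [hop]
  abel
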